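/- Let $\mathrm{M}$ and $\mathrm{N}$ be matroids on finite ground sets $E$ and $F$, with rank functions $\operatorname{rk}_{\mathrm M}$ and $\operatorname{rk}_{\mathrm N}$, and let $n=|E|$. Let $f:\mathrm{M}\to\mathrm{N}$ be a morphism of matroids, that is, a function $f:E\to F$ such that $$\operatorname{rk}_{\mathrm{N}}(f(S_2))-\operatorname{rk}_{\mathrm{N}}(f(S_1))\le \operatorname{rk}_{\mathrm{M}}(S_2)-\operatorname{rk}_{\mathrm{M}}(S_1)\quad\text{for all } S_1\subseteq S_2\subseteq E.$$ Call $S\subseteq E$ a basis of $f$ if $S$ is contained in a basis of $\mathrm{M}$ and $f(S)$ contains a basis of $\mathrm{N}$, and let $b_k(f)$ be the number of bases of $f$ of cardinality $k$. Then the sequence $b_k(f)/\binom{n}{k}$, $0\le k\le n$, is log-concave and has no internal zeros: for all $1\le k\le n-1$, $$\frac{b_k(f)^2}{\binom{n}{k}^2}\ \ge\ \frac{b_{k-1}(f)}{\binom{n}{k-1}}\cdot\frac{b_{k+1}(f)}{\binom{n}{k+1}},$$ and for all $0\le i<j<k\le n$, if $b_i(f)/\binom{n}{i}\ne0$ and $b_k(f)/\binom{n}{k}\ne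 0$ then $b_j(f)/\binom{n}{j}\neq 0$. Moreover, the map from $\mathrm{M}$ to $\mathrm{U}_{0,1}$, the matroid of rank zero on one element, is a morphism whose bases are exactly the independent sets of $\mathrm{M}$ (so that the case of this morphism is the strongest form of Mason's conjecture on independent sets). -/

import Mathlib

namespace Matroid

/-- `f` restricts to a function from the ground set of `M` to the ground set of `N` which is a
morphism of matroids `M → N`, that is, `rk_N (f S₂) - rk_N (f S₁) ≤ rk_M S₂ - rk_M S₁` for all
`S₁ ⊆ S₂ ⊆ M.E`. Ranks are `ℕ∞`-valued, so the inequality is written without subtraction. -/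
structure IsMorphism {α β : Type*} (M : Matroid α) (N : Matroid β) (f : α → β) : Prop where
  mapsTo : Set.MapsTo f M.E N.E
  rank_le : ∀ S₁ S₂ : Set α, S₁ ⊆ S₂ → S₂ ⊆ M.E →
    N.eRk (f '' S₂) + M.eRk S₁ ≤ M.eRk S₂ + N.eRk (f '' S₁)

/-- `S` is a basis of the morphism `f : M → N`: it is contained in a basis of `M`, and its image
contains a basis of `N`. -/
def IsMorphismBasis {α β : Type*} (M : Matroid α) (N : Matroid β) (f : α → β) (S : Set α) : Prop :=
  (∃ B, M.IsBase B ∧ S ⊆ B) ∧ (∃ B, N.IsBase B ∧ B ⊆ f '' S)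

/-- The number `b_k(f)` of bases of cardinality `k` of the morphism `f : M → N`. -/
noncomputable def morphismBasisCount {α β : Type*} (M : Matroid α) (N : Matroid β) (f : α → β)
    (k : ℕ) : ℕ :=
  {S : Set α | IsMorphismBasis M N f S ∧ S.encard = k}.ncard

/-- The matroid `U_{0,1}`: the matroid of rank zero on a one-element ground set. -/
def uniformZeroOne : Matroid Unit := loopyOn Set.univ

end Matroid

/-! Restrict `M` to its ground set as a matroid `P`, and pull `N` back along `f` to a matroid `K` on
the same set. When the image of the ground set spans `N`, the bases of `f` are the sets that are
independent in `P` and spanning in `K`. The morphism condition gives `P.closure X ⊆ K.closure X`.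

Consider the homogeneous polynomial `∑ w₀^(n - |S|) ∏_{i ∈ S} wᵢ` over such sets `S`. With `n = a +
k + 2`, apply `∂₀^a` and the derivatives indexed by a multiset `L`, and take the Hessian at `w₀ =
0`, `wᵢ = 1`. Divided by `a!`, its entries count sets of sizes `k + 2`, `k + 1`, `k` containing `L`,
with border factors `a + 1` and `(a + 1)(a + 2)`: this is `indepSpanningForm`. The aim is a reverse
Cauchy-Schwarz inequality for it. At `L = 0`, for the vectors `(0; 1)` and `(1, …, 1; 0)`, this
inequality is ultra-log-concavity.

The proof is by induction on `k - |L|`. If `|L| = k`, the form is explicit and is controlled by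
parallel classes in a contraction (`exists_indepSpanningForm_nonpos`). Otherwise Euler's identity
(`sum_indepSpanningForm_cons`) averages the inequalities for all `i ::ₘ L` into a Bochner
inequality. A spectral argument (`bordered_quadForm_nonpos`), together with connectedness of the
graph of nonzero entries (`exists_common_neighbor`), turns this into at most one positive direction.
As `w₀ = 0`, Euler's identity has no `w₀` term; hence the border is treated apart from the matrix.

There are no internal zeros because an independent spanning set can be augmented inside `P` one
element at a time and stays spanning. -/

section

open scoped RealInnerProductSpace

/-! ### Linear algebra: reverse Cauchy-Schwarz and Bochner-type criteria. -/

/-- A quadratic form which is nonpositive on the kernel of a linear form satisfies the reverse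
Cauchy-Schwarz inequality; only the values used on the span of two vectors enter. -/
theorem reverse_cauchy_schwarz_of_nonpos {qxx qxy qyy ax ay : ℝ}
    (h : ∀ s t : ℝ, s * ax + t * ay = 0 → s ^ 2 * qxx + 2 * s * t * qxy + t ^ 2 * qyy ≤ 0)
    (hy : 0 ≤ qyy) : qxx * qyy ≤ qxy ^ 2 := by
  rcases hy.eq_or_lt with hy | hy
  · rw [← hy]; nlinarith
  have hay : ay ≠ 0 := by
    rintro rfl
    have := h 0 1 (by ring)
    linarith
  have h1 := h ay (-ax) (by ring)
  have hay2 : 0 < ay ^ 2 := by positivity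
  have h2 : ay ^ 2 * (qxx * qyy) ≤ ay ^ 2 * qxy ^ 2 := by
    have := mul_le_mul_of_nonneg_right h1 hy.le
    nlinarith [sq_nonneg (ax * qyy - ay * qxy)]
  exact le_of_mul_le_mul_left h2 hay2

namespace LinearMap.IsSymmetric

variable {F : Type*} [NormedAddCommGroup F] [InnerProductSpace ℝ F] [FiniteDimensional ℝ F]
  {S : F →ₗ[ℝ] F} {e c : F} {γ : ℝ}

theorem inner_apply_self_nonpos_of_eigenvalues (hS : S.IsSymmetric) {z : F}
    (h : ∀ (v : F) (μ : ℝ), 0 < μ → S v = μ • v → ⟪v, z⟫ = 0) : ⟪z, S z⟫ ≤ 0 := by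
  set B := hS.eigenvectorBasis rfl
  rw [← B.sum_inner_mul_inner z (S z)]
  refine Finset.sum_nonpos fun i _ => ?_
  have hi : S (B i) = hS.eigenvalues rfl i • B i := hS.apply_eigenvectorBasis rfl i
  rw [← hS, hi, real_inner_smul_left]
  rcases lt_or_ge 0 (hS.eigenvalues rfl i) with hpos | hneg
  · rw [h _ _ hpos hi]; simp
  · rw [real_inner_comm]
    nlinarith [mul_self_nonneg ⟪B i, z⟫]

/-- A Bochner-type criterion for a quadratic form on `F × ℝ` to be nonpositive on the
orthogonal complement of `(e, 0)`. -/
theorem nonpos_of_le_norm_sq (hS : S.IsSymmetric) (he : S e = e)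
    (hle : ∀ (y : F) (τ : ℝ), ⟪y, S y⟫ + 2 * τ * ⟪c, y⟫ + γ * τ ^ 2 ≤ ‖S y + τ • c‖ ^ 2)
    (heig : ∀ (y : F) (μ : ℝ), 1 ≤ μ → S y = μ • y → ∃ k : ℝ, y = k • e)
    {y : F} {τ : ℝ} (hy : ⟪e, y⟫ + τ * ⟪e, c⟫ = 0) :
    ⟪y, S y⟫ + 2 * τ * ⟪c, y⟫ + γ * τ ^ 2 ≤ 0 := by
  have hneg : ∀ z : F, ⟪e, z⟫ = 0 → ⟪z, S z⟫ ≤ 0 := by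
    intro z hz
    refine hS.inner_apply_self_nonpos_of_eigenvalues fun v μ hμ hv => ?_
    by_cases hv0 : v = 0
    · simp [hv0]
    -- On an eigenvector with `τ = 0` the hypothesis reads `μ ≤ μ ^ 2`, so a positive eigenvalue is
    -- at least `1` and its eigenvectors are multiples of `e`.
    have h1 := hle v 0
    have hvpos : 0 < ‖v‖ ^ 2 := by positivity
    simp only [hv, real_inner_smul_right, real_inner_self_eq_norm_sq, zero_smul, add_zero,
      norm_smul, mul_pow, mul_zero, zero_mul, Real.norm_eq_abs, sq_abs] at h1
    have h2 : μ ≤ μ ^ 2 := by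
      refine le_of_mul_le_mul_right ?_ hvpos
      simpa using h1
    obtain ⟨k, hk⟩ := heig v μ (by nlinarith) hv
    rw [hk, real_inner_smul_left, hz, mul_zero]
  set u : F := S y + τ • c with hu
  -- Split `u = S z + u'` with `u'` orthogonal to the range of `S`, hence in its kernel. Moving `y`
  -- by `-z` leaves only `u'` on the right of `hle`.
  obtain ⟨_, ⟨z, rfl⟩, u', hu', huz⟩ :=
    Submodule.exists_add_mem_mem_orthogonal (K := LinearMap.range S) u
  have horth : ∀ w, ⟪S w, u'⟫ = 0 := fun w =>
    (Submodule.mem_orthogonal _ _).1 hu' _ ⟨w, rfl⟩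
  have hSu' : S u' = 0 := by
    rw [← inner_self_eq_zero (𝕜 := ℝ), ← hS, horth]
  have heu' : ⟪e, u'⟫ = 0 := by simpa [he] using horth e
  have hez : ⟪e, z⟫ = 0 := by
    have h1 : ⟪e, u⟫ = 0 := by
      rw [hu, inner_add_right, ← hS, he, real_inner_smul_right, hy]
    rw [huz, inner_add_right, heu', ← hS, he, add_zero] at h1
    exact h1
  have hc : τ • c = S z + u' - S y := by rw [← huz, hu]; abel
  have hcw : ∀ w, τ * ⟪c, w⟫ = ⟪S z, w⟫ + ⟪u', w⟫ - ⟪S y, w⟫ := fun w => by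
    rw [← real_inner_smul_left, hc, inner_sub_left, inner_add_left]
  have key : ∀ s : ℝ, ⟪y, S y⟫ + 2 * τ * ⟪c, y⟫ + γ * τ ^ 2 - ⟪z, S z⟫
      - 2 * ⟪u', z⟫ + 2 * s * ‖u'‖ ^ 2 ≤ ‖u'‖ ^ 2 := by
    intro s
    have h1 := hle (y - z + s • u') τ
    have h2 : S (y - z + s • u') + τ • c = u' := by
      rw [map_add, map_sub, map_smul, hSu', hc, smul_zero]; abel
    rw [h2] at h1
    refine le_trans (le_of_eq ?_) h1
    have h3 : ⟪y - z + s • u', S (y - z + s • u')⟫ = ⟪y, S y⟫ - 2 * ⟪S y, z⟫ + ⟪z, S z⟫ := by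
      have h4 : S (y - z + s • u') = S y - S z := by
        rw [map_add, map_sub, map_smul, hSu', smul_zero, add_zero]
      rw [h4, inner_add_left, real_inner_smul_left, inner_sub_right u', real_inner_comm (S y),
        real_inner_comm (S z) u', horth, horth, inner_sub_left, inner_sub_right, inner_sub_right,
        real_inner_comm (S y) z, ← hS y z]
      ring
    rw [h3, mul_assoc 2 τ, hcw, mul_assoc 2 τ, hcw]
    simp only [inner_add_right, inner_sub_right, real_inner_smul_right, horth,
      real_inner_self_eq_norm_sq]
    rw [real_inner_comm z (S z)]
    ring
  -- The left side of `key` is affine in `s` with slope `2 * ‖u'‖ ^ 2`, yet bounded above; so the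
  -- slope is zero.
  have hu0 : u' = 0 := by
    by_contra hne
    have hpos : 0 < ‖u'‖ ^ 2 := by positivity
    set C := ⟪y, S y⟫ + 2 * τ * ⟪c, y⟫ + γ * τ ^ 2 - ⟪z, S z⟫ - 2 * ⟪u', z⟫
    have := key ((‖u'‖ ^ 2 - C + 1) / (2 * ‖u'‖ ^ 2))
    have h5 : 2 * ((‖u'‖ ^ 2 - C + 1) / (2 * ‖u'‖ ^ 2)) * ‖u'‖ ^ 2 = ‖u'‖ ^ 2 - C + 1 := by
      field_simp
    linarith
  have h6 := key 0
  rw [hu0] at h6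
  simp only [inner_zero_left, norm_zero] at h6
  linarith [hneg z hez]

end LinearMap.IsSymmetric

/-- A Bochner-type criterion for a bordered nonnegative symmetric matrix `R`: the associated
quadratic form is nonpositive on the orthogonal complement of the all-ones vector. -/
theorem bordered_quadForm_nonpos {ι : Type*} [Fintype ι] {R : ι → ι → ℝ} {q : ι → ℝ} {γ : ℝ}
    (hsymm : ∀ i j, R i j = R j i) (hnn : ∀ i j, 0 ≤ R i j)
    (hq : ∀ i, ∑ j, R i j = 0 → q i = 0)
    (hle : ∀ (x : ι → ℝ) (τ : ℝ),
      ∑ i, x i * ∑ j, R i j * x j + 2 * τ * ∑ i, q i * x i + γ * τ ^ 2 ≤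
        ∑ i, (∑ j, R i j * x j + τ * q i) ^ 2 / ∑ j, R i j)
    (hconn : ∀ x : ι → ℝ, (∀ i j, 0 < R i j → x i = x j) →
      ∀ i j, 0 < ∑ k, R i k → 0 < ∑ k, R j k → x i = x j)
    {x : ι → ℝ} {τ : ℝ} (hx : ∑ i, (∑ j, R i j * x j + τ * q i) = 0) :
    ∑ i, x i * ∑ j, R i j * x j + 2 * τ * ∑ i, q i * x i + γ * τ ^ 2 ≤ 0 := by
  classical
  set D : ι → ℝ := fun i => ∑ j, R i j with hD
  have hD0 : ∀ i, 0 ≤ D i := fun i => Finset.sum_nonneg fun j _ => hnn i j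
  have hRD : ∀ i j, D i = 0 → R i j = 0 := fun i j h =>
    (Finset.sum_eq_zero_iff_of_nonneg fun j _ => hnn i j).1 h j (Finset.mem_univ j)
  set w : ι → ℝ := fun i => √(D i) with hw
  -- Where `D i = 0` the inverse is `0` by convention. Row `i` of `R` and `q i` vanish there, so
  -- nothing is lost in the normalization `D^(-1/2) R D^(-1/2)`, which fixes `e = D^(1/2) 1`.
  set v : ι → ℝ := fun i => (√(D i))⁻¹ with hv
  have hww : ∀ i, w i * w i = D i := fun i => Real.mul_self_sqrt (hD0 i)
  have hvw : ∀ i, D i ≠ 0 → v i * w i = 1 := fun i h =>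
    inv_mul_cancel₀ (Real.sqrt_ne_zero'.2 ((hD0 i).lt_of_ne' h))
  have hvv : ∀ i, v i * v i = (D i)⁻¹ := fun i => by
    rw [hv]; simp only; rw [← mul_inv, Real.mul_self_sqrt (hD0 i)]
  have hRvw : ∀ i j, R i j * (v j * w j) = R i j := fun i j => by
    by_cases h : D j = 0
    · rw [hsymm, hRD j i h, zero_mul]
    · rw [hvw j h, mul_one]
  have hqvw : ∀ j, q j * (v j * w j) = q j := fun j => by
    by_cases h : D j = 0
    · rw [hq j h, zero_mul]
    · rw [hvw j h, mul_one]
  set A : Matrix ι ι ℝ := Matrix.of fun i j => v i * R i j * v j with hA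
  set S := Matrix.toEuclideanLin A with hS'
  have hSapp : ∀ (y : EuclideanSpace ℝ ι) i, S y i = v i * ∑ j, R i j * (v j * y j) := by
    intro y i
    simp only [hS', hA, Matrix.toLpLin_apply, Matrix.mulVec, dotProduct, Matrix.of_apply,
      Finset.mul_sum]
    exact Finset.sum_congr rfl fun j _ => by ring
  have hSsymm : S.IsSymmetric := by
    rw [hS', Matrix.isSymmetric_toEuclideanLin_iff]
    ext i j
    simp only [hA, Matrix.conjTranspose_apply, Matrix.of_apply, star_trivial]
    rw [hsymm j i]; ring
  set e : EuclideanSpace ℝ ι := WithLp.toLp 2 w with he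
  set c : EuclideanSpace ℝ ι := WithLp.toLp 2 fun i => v i * q i with hc
  have hinner : ∀ y z : EuclideanSpace ℝ ι, ⟪y, z⟫ = ∑ i, y i * z i := fun y z => by
    simp [PiLp.inner_apply, mul_comm]
  have hform : ∀ y : EuclideanSpace ℝ ι,
      ⟪y, S y⟫ = ∑ i, (v i * y i) * ∑ j, R i j * (v j * y j) := fun y => by
    rw [hinner]
    exact Finset.sum_congr rfl fun i _ => by rw [hSapp]; ring
  have hcform : ∀ y : EuclideanSpace ℝ ι, ⟪c, y⟫ = ∑ i, q i * (v i * y i) := fun y => by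
    rw [hinner]
    exact Finset.sum_congr rfl fun i _ => by simp only [hc]; ring
  have hSe : S e = e := by
    ext i
    rw [hSapp]
    simp only [he, hRvw]
    change v i * D i = w i
    by_cases h : D i = 0
    · simp [hw, h]
    · rw [← hww, ← mul_assoc, hvw i h, one_mul]
  have hle' : ∀ (y : EuclideanSpace ℝ ι) (t : ℝ),
      ⟪y, S y⟫ + 2 * t * ⟪c, y⟫ + γ * t ^ 2 ≤ ‖S y + t • c‖ ^ 2 := by
    intro y t
    rw [hform, hcform]
    refine (hle (fun i => v i * y i) t).trans (le_of_eq ?_)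
    rw [EuclideanSpace.norm_sq_eq]
    refine Finset.sum_congr rfl fun i _ => ?_
    simp only [PiLp.add_apply, PiLp.smul_apply, hSapp, hc, smul_eq_mul, Real.norm_eq_abs, sq_abs]
    rw [div_eq_mul_inv, ← hvv]
    ring
  have heig : ∀ (y : EuclideanSpace ℝ ι) (μ : ℝ), 1 ≤ μ → S y = μ • y → ∃ k : ℝ, y = k • e := by
    intro y μ hμ hy
    set z : ι → ℝ := fun i => v i * y i with hz
    have hyi : ∀ i, v i * ∑ j, R i j * z j = μ * y i := fun i => by
      rw [← hSapp, hy]; rfl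
    have hy0 : ∀ i, D i = 0 → y i = 0 := fun i h => by
      have h1 := hyi i
      rw [Finset.sum_eq_zero fun j _ => by rw [hRD i j h, zero_mul], mul_zero] at h1
      exact (mul_eq_zero.1 h1.symm).resolve_left (by linarith)
    have hyz : ∀ i, y i = w i * z i := fun i => by
      by_cases h : D i = 0
      · simp [hz, hy0 i h]
      · rw [hz, ← mul_assoc, mul_comm (w i), hvw i h, one_mul]
    have hRz : ∀ i, ∑ j, R i j * z j = μ * (D i * z i) := fun i => by
      by_cases h : D i = 0
      · rw [Finset.sum_eq_zero fun j _ => by rw [hRD i j h, zero_mul], h]; ring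
      · have h1 := hyi i
        rw [hyz] at h1
        calc ∑ j, R i j * z j = (v i * w i) * ∑ j, R i j * z j := by rw [hvw i h, one_mul]
          _ = w i * (v i * ∑ j, R i j * z j) := by ring
          _ = μ * (D i * z i) := by rw [h1, ← hww]; ring
    -- Dirichlet energy of `z = D^(-1/2) y`: it is nonnegative, while `μ ≥ 1` makes the right side
    -- nonpositive. Hence `z` is constant along positive entries of `R`, and connectedness gives a
    -- multiple of `e`.
    have hsum : ∑ i, ∑ j, R i j * (z i - z j) ^ 2 = 2 * (1 - μ) * ∑ i, D i * z i ^ 2 := by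
      have h1 : ∑ i, ∑ j, R i j * z i ^ 2 = ∑ i, D i * z i ^ 2 :=
        Finset.sum_congr rfl fun i _ => by rw [← Finset.sum_mul]
      have h2 : ∑ i, ∑ j, R i j * z j ^ 2 = ∑ i, D i * z i ^ 2 := by
        rw [Finset.sum_comm, ← h1]
        exact Finset.sum_congr rfl fun i _ => Finset.sum_congr rfl fun j _ => by rw [hsymm]
      have h3 : ∑ i, ∑ j, R i j * (z i * z j) = μ * ∑ i, D i * z i ^ 2 := by
        rw [Finset.mul_sum]
        refine Finset.sum_congr rfl fun i _ => ?_
        rw [show μ * (D i * z i ^ 2) = z i * (μ * (D i * z i)) by ring, ← hRz, Finset.mul_sum]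
        exact Finset.sum_congr rfl fun j _ => by ring
      calc ∑ i, ∑ j, R i j * (z i - z j) ^ 2
          = ∑ i, ∑ j, (R i j * z i ^ 2 + R i j * z j ^ 2 - 2 * (R i j * (z i * z j))) :=
            Finset.sum_congr rfl fun i _ => Finset.sum_congr rfl fun j _ => by ring
        _ = _ := by
            simp only [Finset.sum_sub_distrib, Finset.sum_add_distrib, ← Finset.mul_sum]
            rw [h1, h2, h3]; ring
    have hterm : ∀ i j, 0 ≤ R i j * (z i - z j) ^ 2 := fun i j =>
      mul_nonneg (hnn i j) (sq_nonneg _)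
    have hsum0 : ∑ i, ∑ j, R i j * (z i - z j) ^ 2 = 0 := by
      refine le_antisymm ?_ (Finset.sum_nonneg fun i _ => Finset.sum_nonneg fun j _ => hterm i j)
      rw [hsum]
      have : 0 ≤ ∑ i, D i * z i ^ 2 :=
        Finset.sum_nonneg fun i _ => mul_nonneg (hD0 i) (sq_nonneg _)
      nlinarith
    have hzz : ∀ i j, 0 < R i j → z i = z j := by
      intro i j hij
      have h1 := (Finset.sum_eq_zero_iff_of_nonneg fun i _ =>
        Finset.sum_nonneg fun j _ => hterm i j).1 hsum0 i (Finset.mem_univ i)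
      have h2 := (Finset.sum_eq_zero_iff_of_nonneg fun j _ => hterm i j).1 h1 j
        (Finset.mem_univ j)
      have h3 := (mul_eq_zero.1 h2).resolve_left hij.ne'
      exact sub_eq_zero.1 (pow_eq_zero_iff two_ne_zero |>.1 h3)
    by_cases hex : ∃ i, D i ≠ 0
    · obtain ⟨i, hi⟩ := hex
      refine ⟨z i, ?_⟩
      ext j
      by_cases hj : D j = 0
      · simp [hy0 j hj, he, hw, hj]
      · rw [hyz, hconn z hzz j i ((hD0 j).lt_of_ne' hj) ((hD0 i).lt_of_ne' hi), mul_comm]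
        rfl
    · push Not at hex
      refine ⟨0, ?_⟩
      ext j
      simp [hy0 j (hex j)]
  have hfin := hSsymm.nonpos_of_le_norm_sq hSe hle' heig
    (y := WithLp.toLp 2 fun i => w i * x i) (τ := τ) ?_
  · rw [hform, hcform] at hfin
    refine le_trans (le_of_eq ?_) hfin
    have h1 : ∀ i j, R i j * (v j * (w j * x j)) = R i j * x j := fun i j => by
      rw [← mul_assoc (v j), ← mul_assoc, hRvw]
    have h2 : ∀ i, q i * (v i * (w i * x i)) = q i * x i := fun i => by
      rw [← mul_assoc (v i), ← mul_assoc, hqvw]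
    simp only [h1, h2]
    congr 2
    refine Finset.sum_congr rfl fun i _ => ?_
    by_cases h : D i = 0
    · rw [Finset.sum_eq_zero fun j _ => by rw [hRD i j h, zero_mul]]; simp
    · rw [← mul_assoc (v i), hvw i h, one_mul]
  · rw [hinner, hinner, ← hx, Finset.sum_add_distrib, Finset.sum_comm, Finset.mul_sum]
    congr 1
    · refine Finset.sum_congr rfl fun i _ => ?_
      rw [← Finset.sum_mul, Finset.sum_congr rfl fun j _ => hsymm j i]
      change w i * (w i * x i) = D i * x i
      rw [← mul_assoc, hww]
    · refine Finset.sum_congr rfl fun i _ => ?_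
      change τ * (w i * (v i * q i)) = τ * q i
      rw [show w i * (v i * q i) = q i * (v i * w i) by ring, hqvw]

end

/-! ### Exchange properties of sets independent in `P` and spanning in `K`. -/

namespace Matroid

variable {ι : Type*} {P K : Matroid ι}

theorem exists_superset_indep_spanning (hK : K.E = Set.univ) {m : ℕ}
    (hm : (m : ℕ∞) ≤ P.eRank) {S : Finset ι}
    (hS : P.Indep (S : Set ι)) (hS' : K.Spanning (S : Set ι)) (hSm : S.card ≤ m) :
    ∃ T : Finset ι, S ⊆ T ∧ P.Indep (T : Set ι) ∧ K.Spanning (T : Set ι) ∧ T.card = m := by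
  classical
  induction h : m - S.card generalizing S with
  | zero => exact ⟨S, subset_rfl, hS, hS', by omega⟩
  | succ d ih =>
    obtain ⟨B, hB⟩ := P.exists_isBase
    have hlt : (S : Set ι).encard < B.encard := by
      rw [hB.encard_eq_eRank, Set.encard_coe_eq_coe_finsetCard]
      exact lt_of_lt_of_le (by exact_mod_cast (by omega : S.card < m)) hm
    obtain ⟨e, he, hi⟩ := hS.augment hB.indep hlt
    have heS : e ∉ S := fun h => he.2 h
    obtain ⟨T, hT, hT'⟩ := ih (S := insert e S) (by simpa using hi)
      (hS'.superset (by simp) (by simp [hK]))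
      (by rw [Finset.card_insert_of_notMem heS]; omega)
      (by rw [Finset.card_insert_of_notMem heS]; omega)
    exact ⟨T, (Finset.subset_insert e S).trans hT, hT'⟩

/-- A set `X` that is contained in an `m`-element `P`-independent and `K`-spanning set can be
extended to one by adding elements of any other such set. -/
theorem exists_indep_spanning_between [Finite ι] (hP : P.E = Set.univ) (hK : K.E = Set.univ)
    (hcl : ∀ X, P.closure X ⊆ K.closure X) {m : ℕ} {X S : Finset ι}
    (hX : P.Indep (X : Set ι)) (hXm : K.eRank + X.card ≤ K.eRk (X : Set ι) + m)
    (hXc : X.card ≤ m)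
    (hS : P.Indep (S : Set ι)) (hS' : K.Spanning (S : Set ι)) (hSm : S.card = m) :
    ∃ T : Finset ι, X ⊆ T ∧ (∀ e ∈ T, e ∈ X ∨ e ∈ S) ∧
      P.Indep (T : Set ι) ∧ K.Spanning (T : Set ι) ∧ T.card = m := by
  classical
  induction h : m - X.card generalizing X with
  | zero =>
    have hc : X.card = m := by omega
    refine ⟨X, subset_rfl, fun e he => Or.inl he, hX, ?_, hc⟩
    rw [hc] at hXm
    rw [spanning_iff_eRk_le (by simp [hK])]
    exact (ENat.add_le_add_iff_right (ENat.natCast_ne_top m)).1 hXm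
  | succ d ih =>
    suffices ∃ e ∈ S, e ∉ X ∧ P.Indep (insert e X : Set ι) ∧
        K.eRank + X.card + 1 ≤ K.eRk (insert e X : Set ι) + m by
      obtain ⟨e, heS, heX, hi, hr⟩ := this
      obtain ⟨T, hT, hT', hT''⟩ := ih (X := insert e X) (by simpa using hi)
        (by
          rw [Finset.card_insert_of_notMem heX, Finset.coe_insert]
          push_cast
          rw [← add_assoc]
          exact hr)
        (by rw [Finset.card_insert_of_notMem heX]; omega)
        (by rw [Finset.card_insert_of_notMem heX]; omega)
      refine ⟨T, (Finset.subset_insert e X).trans hT, fun f hf => ?_, hT''⟩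
      rcases hT' f hf with h | h
      · rcases Finset.mem_insert.1 h with rfl | h
        · exact Or.inr heS
        · exact Or.inl h
      · exact Or.inr h
    -- The hypothesis `hXm` says that the `K`-rank missing from `X` is at most the number of
    -- elements still to be added. An element of `S` outside `K.closure X` lowers both by one and
    -- keeps `P`-independence; if there is none, `X` already spans `K` and any augmentation in `P`
    -- will do.
    by_cases hsub : (S : Set ι) ⊆ K.closure X
    · have hXs : K.Spanning (X : Set ι) := by
        rw [spanning_iff_ground_subset_closure (by simp [hK]), ← hS'.closure_eq]
        exact K.closure_subset_closure_of_subset_closure hsub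
      have hlt : (X : Set ι).encard < (S : Set ι).encard := by
        rw [Set.encard_coe_eq_coe_finsetCard, Set.encard_coe_eq_coe_finsetCard]
        exact_mod_cast (by omega : X.card < S.card)
      obtain ⟨e, he, hi⟩ := hX.augment hS hlt
      refine ⟨e, he.1, he.2, hi, ?_⟩
      rw [(hXs.superset (Set.subset_insert e _) (by simp [hK])).eRk_eq, add_assoc]
      gcongr
      exact_mod_cast (by omega : X.card + 1 ≤ m)
    · obtain ⟨e, heS, he⟩ := Set.not_subset.1 hsub
      have heP : e ∉ P.closure X := fun h => he (hcl _ h)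
      obtain ⟨hi, heX⟩ := (hX.notMem_closure_iff (by simp [hP])).1 heP
      refine ⟨e, heS, heX, hi, ?_⟩
      rw [eRk_insert_eq_add_one ⟨by simp [hK], he⟩, add_right_comm (K.eRk _)]
      exact add_le_add_left hXm 1

/-- For non-loops of the contraction by `A`, equality of these closures is the parallel relation;
this writes entries of the Hessian in terms of parallel classes. -/
theorem notMem_closure_insert_iff_closure_ne (hP : P.E = Set.univ) {A : Set ι} {i j : ι}
    (hi : i ∉ P.closure A) : i ∉ P.closure (insert j A) ↔
      P.closure (insert i A) ≠ P.closure (insert j A) := by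
  constructor
  · intro h heq
    exact h (heq ▸ P.mem_closure_of_mem' (Set.mem_insert i A) (by simp [hP]))
  · intro hne h
    exact hne (closure_insert_congr ⟨h, hi⟩)

theorem spanning_insert_of_notMem_closure (hK : K.E = Set.univ) {A : Set ι} {i l : ι}
    (hl : K.Spanning (insert l A)) (hi : i ∉ K.closure A) : K.Spanning (insert i A) := by
  rw [spanning_iff_closure_eq (by simp [hK])] at hl ⊢
  have hil : i ∈ K.closure (insert l A) := by simp [hl, hK]
  rw [closure_insert_congr ⟨hil, hi⟩, hl]

/-! ### Counting independent spanning sets that contain a given multiset. -/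

variable [Fintype ι]

open Classical in
/-- The number of `k`-element sets that contain the multiset `L`, are independent in `P`
and spanning in `K`. It is zero if `L` has a repeated element. -/
noncomputable def indepSpanningCount (P K : Matroid ι) (k : ℕ) (L : Multiset ι) : ℕ :=
  (Finset.univ.filter fun S : Finset ι =>
    (P.Indep (S : Set ι) ∧ K.Spanning (S : Set ι) ∧ S.card = k) ∧ L ≤ S.val).card

theorem indepSpanningCount_pos_iff {k : ℕ} {L : Multiset ι} :
    0 < P.indepSpanningCount K k L ↔ ∃ S : Finset ι,
      (P.Indep (S : Set ι) ∧ K.Spanning (S : Set ι) ∧ S.card = k) ∧ L ≤ S.val := by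
  classical
  simp [indepSpanningCount, Finset.card_pos, Finset.Nonempty]

theorem indepSpanningCount_cons_swap (k : ℕ) (i j : ι) (L : Multiset ι) :
    P.indepSpanningCount K k (i ::ₘ j ::ₘ L) = P.indepSpanningCount K k (j ::ₘ i ::ₘ L) := by
  rw [Multiset.cons_swap]

theorem card_filter_cons_le_val [DecidableEq ι] {L : Multiset ι} {S : Finset ι}
    (hL : L ≤ S.val) :
    ((Finset.univ.filter fun i => i ::ₘ L ≤ S.val).card : ℝ) = S.card - Multiset.card L := by
  have hnd : L.Nodup := Multiset.nodup_of_le hL S.nodup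
  have h1 : (Finset.univ.filter fun i => i ::ₘ L ≤ S.val) = S \ L.toFinset := by
    ext i
    simp only [Finset.mem_filter, Finset.mem_univ, true_and, Finset.mem_sdiff,
      Multiset.mem_toFinset]
    constructor
    · intro h
      exact ⟨Multiset.mem_of_le h (Multiset.mem_cons_self i L),
        (Multiset.nodup_cons.1 (Multiset.nodup_of_le h S.nodup)).1⟩
    · rintro ⟨h, h'⟩
      rw [Multiset.le_iff_subset (Multiset.nodup_cons.2 ⟨h', hnd⟩), Multiset.cons_subset]
      exact ⟨h, Multiset.subset_of_le hL⟩
  have h2 : L.toFinset ⊆ S := fun i hi =>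
    Multiset.mem_of_le hL (Multiset.mem_toFinset.1 hi)
  rw [h1, Finset.card_sdiff_of_subset h2, Nat.cast_sub (Finset.card_le_card h2),
    Multiset.toFinset_card_of_nodup hnd]

/-- Euler's identity for counts: a `k`-set containing `L` has `k - |L|` further elements to adjoin,
and repeated elements contribute zero. -/
theorem sum_indepSpanningCount_cons (P K : Matroid ι) (k : ℕ) (L : Multiset ι) :
    ∑ i, (P.indepSpanningCount K k (i ::ₘ L) : ℝ) =
      ((k : ℝ) - Multiset.card L) * P.indepSpanningCount K k L := by
  classical
  simp only [indepSpanningCount, Finset.card_filter, Nat.cast_sum, Finset.mul_sum]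
  rw [Finset.sum_comm]
  refine Finset.sum_congr rfl fun S _ => ?_
  by_cases hS : P.Indep (S : Set ι) ∧ K.Spanning (S : Set ι) ∧ S.card = k
  · by_cases hL : L ≤ S.val
    · have := card_filter_cons_le_val hL
      rw [Finset.card_filter, Nat.cast_sum] at this
      simp only [hS, hL, true_and, and_self, if_true, Nat.cast_one, mul_one, this]
    · have h : ∀ i, ¬ i ::ₘ L ≤ S.val := fun i h => hL ((Multiset.le_cons_self L i).trans h)
      simp [hL, h]
  · simp [hS]

/-- Only `L` itself can be a `k`-set containing `L`, so the counts in the base case are `0` or `1`.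
-/
theorem indepSpanningCount_card_eq [DecidableEq ι] (P K : Matroid ι) (L : Multiset ι) {k : ℕ}
    (hk : Multiset.card L = k) {p : Prop} [Decidable p]
    (hp : L.Nodup ∧ P.Indep (L.toFinset : Set ι) ∧ K.Spanning (L.toFinset : Set ι) ↔ p) :
    P.indepSpanningCount K k L = if p then 1 else 0 := by
  classical
  have heq : ∀ S : Finset ι, S.card = k → L ≤ S.val → S.val = L := fun S hS hL =>
    (Multiset.eq_of_le_of_card_le hL (by rw [hk]; exact hS.le)).symm
  split_ifs with h
  · obtain ⟨hnd, hP, hK⟩ := hp.2 h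
    rw [indepSpanningCount, Finset.card_eq_one]
    refine ⟨L.toFinset, ?_⟩
    ext S
    simp only [Finset.mem_filter, Finset.mem_univ, true_and, Finset.mem_singleton]
    constructor
    · rintro ⟨⟨-, -, hS⟩, hL⟩
      rw [← heq S hS hL, Finset.val_toFinset]
    · rintro rfl
      refine ⟨⟨hP, hK, ?_⟩, ?_⟩
      · rw [Multiset.toFinset_card_of_nodup hnd, hk]
      · rw [Multiset.toFinset_val, hnd.dedup]
  · by_contra hne
    obtain ⟨S, ⟨h1, h2, h3⟩, hL⟩ := indepSpanningCount_pos_iff.1 (Nat.pos_of_ne_zero hne)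
    have := heq S h3 hL
    refine h (hp.1 ⟨this ▸ S.nodup, ?_, ?_⟩)
    · rwa [← this, Finset.val_toFinset]
    · rwa [← this, Finset.val_toFinset]

theorem indepSpanningCount_pos_of_le (hK : K.E = Set.univ) {m k : ℕ}
    (hm : (m : ℕ∞) ≤ P.eRank) (hkm : k ≤ m) {L : Multiset ι}
    (h : 0 < P.indepSpanningCount K k L) : 0 < P.indepSpanningCount K m L := by
  obtain ⟨S, ⟨h1, h2, h3⟩, hL⟩ := indepSpanningCount_pos_iff.1 h
  obtain ⟨T, hST, hT⟩ := exists_superset_indep_spanning hK hm h1 h2 (by omega)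
  exact indepSpanningCount_pos_iff.2 ⟨T, hT, hL.trans (Finset.val_le_iff.2 hST)⟩

/-- Extend `i ::ₘ L` to an admissible set `T` using elements of an admissible `S` containing `j ::ₘ
L`. Either `j ∈ T`, or a new element `k` of `T` lies in `S` too and is joined to `i` by `T` and to
`j` by `S`. Thus the graph of nonzero entries has diameter at most two on its nonzero rows. -/
theorem exists_common_neighbor (hP : P.E = Set.univ) (hK : K.E = Set.univ)
    (hcl : ∀ X, P.closure X ⊆ K.closure X) {m : ℕ} {L : Multiset ι}
    (hL : Multiset.card L + 2 ≤ m) {i j : ι} (hij : i ≠ j)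
    (hi : 0 < P.indepSpanningCount K m (i ::ₘ L)) (hj : 0 < P.indepSpanningCount K m (j ::ₘ L)) :
    0 < P.indepSpanningCount K m (i ::ₘ j ::ₘ L) ∨
      ∃ k, 0 < P.indepSpanningCount K m (i ::ₘ k ::ₘ L) ∧
        0 < P.indepSpanningCount K m (k ::ₘ j ::ₘ L) := by
  classical
  obtain ⟨S₀, ⟨h1, h2, h3⟩, hiS⟩ := indepSpanningCount_pos_iff.1 hi
  obtain ⟨S, ⟨h1', h2', h3'⟩, hjS⟩ := indepSpanningCount_pos_iff.1 hj
  obtain ⟨hiL, hnd⟩ := Multiset.nodup_cons.1 (Multiset.nodup_of_le hiS S₀.nodup)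
  obtain ⟨hjL, -⟩ := Multiset.nodup_cons.1 (Multiset.nodup_of_le hjS S.nodup)
  set X : Finset ι := (i ::ₘ L).toFinset with hX
  have hXc : X.card = Multiset.card L + 1 := by
    rw [hX, Multiset.toFinset_card_of_nodup (Multiset.nodup_of_le hiS S₀.nodup),
      Multiset.card_cons]
  have hXS : X ⊆ S₀ := fun e he => Multiset.mem_of_le hiS (Multiset.mem_toFinset.1 he)
  have hXS' : (X : Set ι) ⊆ S₀ := by exact_mod_cast hXS
  have hrank : K.eRank + X.card ≤ K.eRk (X : Set ι) + m := by
    have h4 := K.eRk_le_eRk_add_eRk_sdiff hXS'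
    rw [h2.eRk_eq] at h4
    have h5 : K.eRk ((S₀ : Set ι) \ X) ≤ ((S₀ \ X).card : ℕ∞) := by
      refine (K.eRk_le_encard _).trans (le_of_eq ?_)
      rw [← Finset.coe_sdiff, Set.encard_coe_eq_coe_finsetCard]
    calc K.eRank + X.card ≤ K.eRk (X : Set ι) + (S₀ \ X).card + X.card := by
          gcongr; exact h4.trans (by gcongr)
      _ = K.eRk (X : Set ι) + m := by
          rw [add_assoc]
          congr 1
          rw [← h3, ← Finset.card_sdiff_add_card_eq_card hXS]
          push_cast
          rfl
  obtain ⟨T, hXT, hT, hT1, hT2, hT3⟩ := exists_indep_spanning_between hP hK hcl (h1.subset hXS')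
    hrank (by omega) h1' h2' h3'
  have hle : ∀ (k l : ι) (U : Finset ι), k ≠ l → k ∉ L → l ∉ L → k ∈ U → l ∈ U →
      (∀ e ∈ L, e ∈ U) → k ::ₘ l ::ₘ L ≤ U.val := by
    intro k l U hkl hk hl hkU hlU hLU
    rw [Multiset.le_iff_subset, Multiset.cons_subset, Multiset.cons_subset]
    · exact ⟨hkU, hlU, hLU⟩
    · simp [hkl, hk, hl, hnd]
  have hLT : ∀ e ∈ L, e ∈ T := fun e he =>
    hXT (Multiset.mem_toFinset.2 (Multiset.mem_cons_of_mem he))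
  have hLS : ∀ e ∈ L, e ∈ S := fun e he =>
    Multiset.mem_of_le hjS (Multiset.mem_cons_of_mem he)
  have hiT : i ∈ T := hXT (Multiset.mem_toFinset.2 (Multiset.mem_cons_self i L))
  have hjS' : j ∈ S := Multiset.mem_of_le hjS (Multiset.mem_cons_self j L)
  by_cases hjT : j ∈ T
  · exact Or.inl (indepSpanningCount_pos_iff.2
      ⟨T, ⟨hT1, hT2, hT3⟩, hle i j T hij hiL hjL hiT hjT hLT⟩)
  · obtain ⟨k, hkT, hkX⟩ := Finset.exists_mem_notMem_of_card_lt_card (by omega : X.card < T.card)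
    have hkS : k ∈ S := (hT k hkT).resolve_left hkX
    have hki : i ≠ k := by rintro rfl; exact hkX (Multiset.mem_toFinset.2 (by simp))
    have hkL : k ∉ L := fun h => hkX (Multiset.mem_toFinset.2 (by simp [h]))
    have hkj : k ≠ j := by rintro rfl; exact hjT hkT
    exact Or.inr ⟨k,
      indepSpanningCount_pos_iff.2 ⟨T, ⟨hT1, hT2, hT3⟩, hle i k T hki hiL hkL hiT hkT hLT⟩,
      indepSpanningCount_pos_iff.2
        ⟨S, ⟨h1', h2', h3'⟩, hle k j S hkj hkL hjL hkS hjS' hLS⟩⟩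

end Matroid

/-! ### Quadratic forms of partitions and bordered matrices. -/

/-- The double sum is the sum of squared class sums of `y`. Cauchy-Schwarz applies over the classes
that meet `V`, of which there are at most `V.card`. -/
theorem sum_sum_ite_eq_nonneg_and_sq_sum_le {ι γ : Type*} [Fintype ι] [DecidableEq γ] (c : ι → γ)
    (V : Finset ι) {y : ι → ℝ} (hy : ∀ i ∉ V, y i = 0) :
    0 ≤ ∑ i, ∑ j, (if c i = c j then y i * y j else 0) ∧
    (∑ i, y i) ^ 2 ≤ V.card * ∑ i, ∑ j, (if c i = c j then y i * y j else 0) := by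
  classical
  have h1 : ∑ i, y i = ∑ i ∈ V, y i :=
    (Finset.sum_subset (Finset.subset_univ V) fun i _ hi => hy i hi).symm
  have h2 : ∑ i, ∑ j, (if c i = c j then y i * y j else 0) =
      ∑ b ∈ V.image c, (∑ i ∈ V with c i = b, y i) ^ 2 := by
    have h3 : ∀ i j, (if c i = c j then y i * y j else 0) =
        ∑ b ∈ V.image c, (if c i = b then y i else 0) * (if c j = b then y j else 0) := by
      intro i j
      by_cases hi : i ∈ V
      · rw [Finset.sum_eq_single_of_mem (c i) (Finset.mem_image_of_mem c hi)]
        · simp [eq_comm]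
        · intro b _ hb
          simp [hb.symm]
      · simp [hy i hi]
    simp only [h3]
    rw [Finset.sum_congr rfl fun i _ => Finset.sum_comm, Finset.sum_comm]
    refine Finset.sum_congr rfl fun b _ => ?_
    rw [← Finset.sum_mul_sum, ← sq, Finset.sum_filter]
    congr 1
    refine (Finset.sum_subset (Finset.subset_univ V) fun i _ hi => ?_).symm
    simp [hy i hi]
  rw [h2]
  refine ⟨Finset.sum_nonneg fun _ _ => sq_nonneg _, ?_⟩
  rw [h1, ← Finset.sum_fiberwise_of_maps_to fun i hi => Finset.mem_image_of_mem c hi]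
  refine sq_sum_le_card_mul_sum_sq.trans ?_
  gcongr
  exact Finset.card_image_le

/-- The quadratic form of the bordered symmetric matrix with blocks `R`, `q`, `γ`. -/
def borderedForm {ι : Type*} [Fintype ι] (R : ι → ι → ℝ) (q : ι → ℝ) (γ : ℝ) (x : ι → ℝ)
    (τ : ℝ) : ℝ :=
  ∑ i, x i * ∑ j, R i j * x j + 2 * τ * ∑ i, q i * x i + γ * τ ^ 2

/-- Reverse Cauchy-Schwarz for `(x; τ)` against `(1, …, 1; 0)`, on which the form takes the value `∑
i, ∑ j, R i j ≥ 0`. -/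
theorem borderedForm_reverse_cauchy_schwarz {ι : Type*} [Fintype ι] {R : ι → ι → ℝ} {q : ι → ℝ}
    {γ : ℝ} (hsymm : ∀ i j, R i j = R j i) (hnn : ∀ i j, 0 ≤ R i j) (u : ι → ℝ) (u₀ : ℝ)
    (h : ∀ x τ, ∑ i, u i * x i + u₀ * τ = 0 → borderedForm R q γ x τ ≤ 0) (x : ι → ℝ) (τ : ℝ) :
    borderedForm R q γ x τ * ∑ i, ∑ j, R i j ≤ (∑ i, (∑ j, R i j * x j + τ * q i)) ^ 2 := by
  refine reverse_cauchy_schwarz_of_nonpos (ax := ∑ i, u i * x i + u₀ * τ) (ay := ∑ i, u i)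
    (fun s t hst => ?_) (Finset.sum_nonneg fun i _ => Finset.sum_nonneg fun j _ => hnn i j)
  refine le_trans (le_of_eq ?_) (h (fun i => s * x i + t) (s * τ) ?_)
  · have h1 : ∑ i, (∑ j, R i j * x j + τ * q i) = ∑ i, x i * ∑ j, R i j + τ * ∑ i, q i := by
      rw [Finset.sum_add_distrib, Finset.sum_comm, Finset.mul_sum]
      congr 1
      refine Finset.sum_congr rfl fun i _ => ?_
      rw [Finset.mul_sum]
      exact Finset.sum_congr rfl fun j _ => by rw [hsymm]; ring
    have h2 : ∑ i, ∑ j, R i j * x j = ∑ i, x i * ∑ j, R i j := by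
      rw [Finset.sum_comm]
      refine Finset.sum_congr rfl fun i _ => ?_
      rw [Finset.mul_sum]
      exact Finset.sum_congr rfl fun j _ => by rw [hsymm]; ring
    have h3 : ∑ i, (s * x i + t) * ∑ j, R i j * (s * x j + t) =
        s ^ 2 * ∑ i, x i * ∑ j, R i j * x j + 2 * s * t * ∑ i, x i * ∑ j, R i j
          + t ^ 2 * ∑ i, ∑ j, R i j := by
      have h4 : ∀ i, (s * x i + t) * ∑ j, R i j * (s * x j + t) =
          s ^ 2 * (x i * ∑ j, R i j * x j) + s * t * (x i * ∑ j, R i j)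
            + s * t * (∑ j, R i j * x j) + t ^ 2 * ∑ j, R i j := by
        intro i
        have h5 : ∑ j, R i j * (s * x j + t) = s * ∑ j, R i j * x j + t * ∑ j, R i j := by
          rw [Finset.mul_sum, Finset.mul_sum, ← Finset.sum_add_distrib]
          exact Finset.sum_congr rfl fun j _ => by ring
        rw [h5]; ring
      simp only [h4, Finset.sum_add_distrib, ← Finset.mul_sum]
      rw [h2]; ring
    have h6 : ∑ i, q i * (s * x i + t) = s * ∑ i, q i * x i + t * ∑ i, q i := by
      rw [Finset.mul_sum, Finset.mul_sum, ← Finset.sum_add_distrib]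
      exact Finset.sum_congr rfl fun j _ => by ring
    rw [h1, borderedForm, borderedForm, h3, h6]
    ring
  · rw [← hst]
    simp only [mul_add, Finset.sum_add_distrib, Finset.mul_sum]
    rw [Finset.sum_congr rfl fun i _ => mul_left_comm (u i) s (x i),
      Finset.sum_congr rfl fun i _ => mul_comm (u i) t]
    ring

/-! ### Base case of the induction: `L` has exactly `k` elements. -/

namespace Matroid

variable {ι : Type*} [Fintype ι] {P K : Matroid ι}

open Classical in
theorem indepSpanningCount_val (A : Finset ι) (hPA : P.Indep (A : Set ι)) :
    P.indepSpanningCount K A.card A.val = if K.Spanning (A : Set ι) then 1 else 0 := by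
  refine indepSpanningCount_card_eq P K _ A.card_val ?_
  simp [A.nodup, hPA]

open Classical in
theorem indepSpanningCount_cons_val (hP : P.E = Set.univ) (A : Finset ι)
    (hPA : P.Indep (A : Set ι)) (i : ι) :
    P.indepSpanningCount K (A.card + 1) (i ::ₘ A.val) =
      if i ∉ P.closure A ∧ K.Spanning (insert i A : Set ι) then 1 else 0 := by
  refine indepSpanningCount_card_eq P K _ (by simp) ?_
  rw [hPA.notMem_closure_iff (by simp [hP])]
  simp only [Multiset.nodup_cons, Multiset.toFinset_cons, Finset.coe_insert, Finset.val_toFinset,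
    Finset.mem_val, Finset.mem_coe, A.nodup]
  tauto

open Classical in
theorem indepSpanningCount_cons_cons_val (hP : P.E = Set.univ) (A : Finset ι)
    (hPA : P.Indep (A : Set ι)) (i j : ι) :
    P.indepSpanningCount K (A.card + 2) (i ::ₘ j ::ₘ A.val) =
      if (j ∉ P.closure A ∧ i ∉ P.closure (insert j A : Set ι)) ∧
        K.Spanning (insert i (insert j A) : Set ι) then 1 else 0 := by
  refine indepSpanningCount_card_eq P K _ (by simp) ?_
  have h : j ∉ P.closure A ∧ i ∉ P.closure (insert j A : Set ι) ↔
      (P.Indep (insert i (insert j A) : Set ι) ∧ i ∉ (insert j A : Set ι)) ∧ j ∉ A := by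
    rw [hPA.notMem_closure_iff (by simp [hP])]
    constructor
    · rintro ⟨⟨h1, h2⟩, h3⟩
      exact ⟨(h1.notMem_closure_iff (by simp [hP])).1 h3, h2⟩
    · rintro ⟨h1, h2⟩
      have h3 := h1.1.subset (Set.subset_insert i _)
      exact ⟨⟨h3, h2⟩, (h3.notMem_closure_iff (by simp [hP])).2 h1⟩
  rw [h]
  simp only [Multiset.nodup_cons, Multiset.toFinset_cons, Finset.coe_insert, Finset.val_toFinset,
    Finset.mem_val, Finset.mem_coe, A.nodup, Multiset.mem_cons, Set.mem_insert_iff]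
  tauto

/-- The bordered quadratic form whose entries count the independent spanning sets of
cardinalities `k + 2`, `k + 1`, `k` that contain `L`. -/
noncomputable def indepSpanningForm (P K : Matroid ι) (a k : ℕ) (L : Multiset ι)
    (x : ι → ℝ) (τ : ℝ) : ℝ :=
  borderedForm (fun i j => (P.indepSpanningCount K (k + 2) (i ::ₘ j ::ₘ L) : ℝ))
    (fun i => (a + 1) * (P.indepSpanningCount K (k + 1) (i ::ₘ L) : ℝ))
    ((a + 1) * (a + 2) * (P.indepSpanningCount K k L : ℝ)) x τ

/-- Here only `P` matters. With `y` the part of `x` on non-loops of the contraction of `P` by `A`,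
the form is `(∑ y)² - Z + 2(a+1)τ ∑ y + (a+1)(a+2)τ²`, `Z` being the sum of squared parallel-class
sums. On the given hyperplane it equals `(a+2)τ² - Z`. -/
theorem indepSpanningForm_nonpos_of_spanning (hP : P.E = Set.univ) (hK : K.E = Set.univ)
    {a : ℕ} {A : Finset ι} (hcard : Fintype.card ι = a + A.card + 2)
    (hPA : P.Indep (A : Set ι)) (hKA : K.Spanning (A : Set ι)) {x : ι → ℝ} {τ : ℝ}
    (hx : ∑ i, (open Classical in if i ∉ P.closure A then (1 : ℝ) else 0) * x i + (a + 2) * τ = 0) :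
    P.indepSpanningForm K a A.card A.val x τ ≤ 0 := by
  classical
  set V : Finset ι := Finset.univ.filter fun i => i ∉ P.closure A with hV
  set y : ι → ℝ := fun i => if i ∉ P.closure A then x i else 0 with hy
  set c : ι → Set ι := fun i => P.closure (insert i (A : Set ι)) with hc
  have hsp : ∀ B : Set ι, (A : Set ι) ⊆ B → K.Spanning B := fun B hB =>
    hKA.superset hB (by simp [hK])
  -- Non-loops avoid `A`, and `a + 2` elements lie outside `A`. This bounds the number of parallel
  -- classes and yields `Z ≥ (a+2)τ²`.
  have hVc : V.card ≤ a + 2 := by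
    have hdis : Disjoint V A := by
      rw [Finset.disjoint_left]
      intro i hi hiA
      exact (Finset.mem_filter.1 hi).2 (P.mem_closure_of_mem' hiA (by simp [hP]))
    have := Finset.card_le_univ (V ∪ A)
    rw [Finset.card_union_of_disjoint hdis] at this
    omega
  have hR : ∀ i j, x i * ((P.indepSpanningCount K (A.card + 2) (i ::ₘ j ::ₘ A.val) : ℝ) * x j) =
      y i * y j - if c i = c j then y i * y j else 0 := by
    intro i j
    rw [indepSpanningCount_cons_cons_val hP A hPA]
    by_cases hi : i ∈ P.closure A
    · have : i ∈ P.closure (insert j A : Set ι) := P.closure_subset_closure (by simp) hi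
      simp [hy, hi, this]
    by_cases hj : j ∈ P.closure A
    · simp [hy, hj]
    have h1 := notMem_closure_insert_iff_closure_ne hP (j := j) hi
    have h2 := hsp (insert i (insert j A : Set ι)) (fun e he => by simp_all)
    by_cases hij : c i = c j
    · have h3 : i ∈ P.closure (insert j A : Set ι) := by
        by_contra h; exact (h1.1 h) hij
      simp [hij, h3]
    · simp [hij, hy, hi, hj, h2, h1.2 hij]
  have hq : ∀ i, (P.indepSpanningCount K (A.card + 1) (i ::ₘ A.val) : ℝ) * x i = y i := by
    intro i
    rw [indepSpanningCount_cons_val hP A hPA]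
    by_cases hi : i ∈ P.closure A <;> simp [hy, hi, hsp (insert i A : Set ι) (by simp)]
  have hX : ∑ i, y i = -((a + 2) * τ) := by
    have : ∀ i, (if i ∉ P.closure A then (1 : ℝ) else 0) * x i = y i := fun i => by simp [hy]
    simp only [this] at hx
    linarith
  obtain ⟨-, hsq⟩ := sum_sum_ite_eq_nonneg_and_sq_sum_le c V (y := y) (fun i hi => by
    simp only [hV, Finset.mem_filter, Finset.mem_univ, true_and, not_not] at hi
    simp [hy, hi])
  have h0 := (sum_sum_ite_eq_nonneg_and_sq_sum_le c V (y := y) (fun i hi => by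
    simp only [hV, Finset.mem_filter, Finset.mem_univ, true_and, not_not] at hi
    simp [hy, hi])).1
  set Z := ∑ i, ∑ j, (if c i = c j then y i * y j else 0) with hZ
  have hform : P.indepSpanningForm K a A.card A.val x τ =
      (∑ i, y i) ^ 2 - Z + 2 * τ * ((a + 1) * ∑ i, y i) + (a + 1) * (a + 2) * τ ^ 2 := by
    rw [indepSpanningForm, borderedForm]
    congr 1
    · congr 1
      · simp only [Finset.mul_sum, hR, Finset.sum_sub_distrib]
        rw [sq, Finset.sum_mul_sum]
      · congr 1
        rw [Finset.mul_sum]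
        exact Finset.sum_congr rfl fun i _ => by rw [mul_assoc, hq]
    · rw [indepSpanningCount_val A hPA, if_pos hKA, Nat.cast_one, mul_one]
  have hle : ((a : ℝ) + 2) * (((a : ℝ) + 2) * τ ^ 2) ≤ (a + 2) * Z := by
    have h1 : (V.card : ℝ) ≤ a + 2 := by exact_mod_cast hVc
    rw [hX] at hsq
    nlinarith [mul_le_mul_of_nonneg_right h1 h0]
  have hle' := le_of_mul_le_mul_left hle (by positivity)
  rw [hform, hX]
  nlinarith

/-- The contraction of `K` by `A` has rank one, so a pair spans when one member is a non-loop of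
`K`. Since `P`-closures lie in `K`-closures, a `P`-parallel class consists wholly of such elements
or contains none. On `∑ y = 0` all terms but minus the squared class sums cancel. -/
theorem indepSpanningForm_nonpos_of_exists_spanning_insert (hP : P.E = Set.univ)
    (hK : K.E = Set.univ) (hcl : ∀ X, P.closure X ⊆ K.closure X)
    {a : ℕ} {A : Finset ι} (hPA : P.Indep (A : Set ι)) (hKA : ¬ K.Spanning (A : Set ι))
    {l : ι} (hl : K.Spanning (insert l A : Set ι)) {x : ι → ℝ} {τ : ℝ}
    (hx : ∑ i, (open Classical in if i ∉ K.closure A then (1 : ℝ) else 0) * x i + 0 * τ = 0) :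
    P.indepSpanningForm K a A.card A.val x τ ≤ 0 := by
  classical
  set y : ι → ℝ := fun i => if i ∉ K.closure A then x i else 0 with hy
  set z : ι → ℝ := fun i => if i ∉ P.closure A then x i else 0 with hz
  set c : ι → Set ι := fun i => P.closure (insert i (A : Set ι)) with hc
  have hspan : ∀ i, i ∉ K.closure A ↔ K.Spanning (insert i A : Set ι) := by
    refine fun i => ⟨spanning_insert_of_notMem_closure hK hl, fun h hi => hKA ?_⟩
    rw [spanning_iff_closure_eq (by simp [hK])] at h ⊢
    rwa [closure_insert_eq_of_mem_closure hi] at h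
  have hmem : ∀ i, i ∈ P.closure A → i ∈ K.closure A := fun i hi => hcl _ hi
  have hR : ∀ i j, x i * ((P.indepSpanningCount K (A.card + 2) (i ::ₘ j ::ₘ A.val) : ℝ) * x j) =
      (y i * z j + z i * y j - y i * y j) - if c i = c j then y i * y j else 0 := by
    intro i j
    rw [indepSpanningCount_cons_cons_val hP A hPA]
    by_cases hi : i ∈ P.closure A
    · have : i ∈ P.closure (insert j A : Set ι) := P.closure_subset_closure (by simp) hi
      simp [hy, hz, hi, hmem i hi, this]
    by_cases hj : j ∈ P.closure A
    · simp [hy, hz, hj, hmem j hj]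
    have h1 := notMem_closure_insert_iff_closure_ne hP (j := j) hi
    have hs : K.Spanning (insert i (insert j A) : Set ι) ↔
        i ∉ K.closure A ∨ j ∉ K.closure A := by
      constructor
      · intro h
        by_contra! hcon
        refine hKA ?_
        rw [spanning_iff_closure_eq (by simp [hK])] at h ⊢
        have hi' : i ∈ K.closure (insert j A : Set ι) :=
          K.closure_subset_closure (by simp) hcon.1
        rwa [closure_insert_eq_of_mem_closure hi',
          closure_insert_eq_of_mem_closure hcon.2] at h
      · rintro (h | h)
        · exact ((hspan i).1 h).superset (by gcongr; simp) (by simp [hK])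
        · exact ((hspan j).1 h).superset (by simp) (by simp [hK])
    by_cases hij : c i = c j
    · have h3 : i ∈ P.closure (insert j A : Set ι) := by
        by_contra h; exact (h1.1 h) hij
      have h4 : j ∈ P.closure (insert i A : Set ι) := by
        have : j ∈ c j := P.mem_closure_of_mem' (Set.mem_insert j A) (by simp [hP])
        rwa [← hij] at this
      have h5 : i ∈ K.closure A ↔ j ∈ K.closure A := by
        constructor
        · intro h
          rw [← closure_insert_eq_of_mem_closure h]
          exact hcl _ h4
        · intro h
          rw [← closure_insert_eq_of_mem_closure h]
          exact hcl _ h3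
      by_cases h6 : j ∈ K.closure A
      · simp [hij, h3, hy, h5.2 h6, h6]
      · simp [hij, h3, hy, hz, h5, h6, hi, hj]
    · by_cases h6 : i ∈ K.closure A <;> by_cases h7 : j ∈ K.closure A <;>
        simp [hij, hy, hz, hi, hj, h6, h7, hs, h1.2 hij]
  have hX : ∑ i, y i = 0 := by
    have : ∀ i, (if i ∉ K.closure A then (1 : ℝ) else 0) * x i = y i := fun i => by simp [hy]
    simp only [this] at hx
    linarith
  have hq : ∀ i, (P.indepSpanningCount K (A.card + 1) (i ::ₘ A.val) : ℝ) * x i = y i := by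
    intro i
    rw [indepSpanningCount_cons_val hP A hPA]
    by_cases hi : i ∈ K.closure A
    · simp [hy, hi, ← hspan]
    · have : i ∉ P.closure A := fun h => hi (hmem i h)
      simp [hy, hi, ← hspan, this]
  have h0 := (sum_sum_ite_eq_nonneg_and_sq_sum_le c Finset.univ (y := y) (fun i hi => by
    simp at hi)).1
  have hform : P.indepSpanningForm K a A.card A.val x τ =
      - ∑ i, ∑ j, (if c i = c j then y i * y j else 0) := by
    have h1 : ∑ i, (a + 1) * (P.indepSpanningCount K (A.card + 1) (i ::ₘ A.val) : ℝ) * x i = 0 := by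
      simp only [mul_assoc, hq]
      rw [← Finset.mul_sum, hX, mul_zero]
    have h2 : ∑ i, x i * ∑ j,
        (P.indepSpanningCount K (A.card + 2) (i ::ₘ j ::ₘ A.val) : ℝ) * x j =
        - ∑ i, ∑ j, (if c i = c j then y i * y j else 0) := by
      simp only [Finset.mul_sum, hR, Finset.sum_sub_distrib, Finset.sum_add_distrib]
      rw [← Finset.sum_mul_sum, ← Finset.sum_mul_sum, ← Finset.sum_mul_sum, hX]
      ring
    rw [indepSpanningForm, borderedForm, h1, h2, indepSpanningCount_val A hPA, if_neg hKA]
    simp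
  rw [hform]
  linarith

/-- The border vanishes. A pair that completes `A` to a `K`-spanning set is automatically
`P`-independent over `A`, so the matrix is that of a complete multipartite graph on `K`-parallel
classes, possibly empty. -/
theorem indepSpanningForm_nonpos_of_not_spanning_insert (hP : P.E = Set.univ)
    (hK : K.E = Set.univ) (hcl : ∀ X, P.closure X ⊆ K.closure X)
    {a : ℕ} {A : Finset ι} (hPA : P.Indep (A : Set ι))
    (hKA' : ¬ K.Spanning (A : Set ι)) (hKA : ∀ l, ¬ K.Spanning (insert l A : Set ι)) {x : ι → ℝ} {τ : ℝ}
    (hx : ∑ i, (open Classical in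
      if ∃ l, K.Spanning (insert l (insert i A) : Set ι) then (1 : ℝ) else 0) * x i + 0 * τ = 0) :
    P.indepSpanningForm K a A.card A.val x τ ≤ 0 := by
  classical
  set y : ι → ℝ := fun i =>
    if ∃ l, K.Spanning (insert l (insert i A) : Set ι) then x i else 0 with hy
  set c : ι → Set ι := fun i => K.closure (insert i (A : Set ι)) with hc
  have hns : ∀ i j, i ∈ K.closure (insert j A : Set ι) →
      ¬ K.Spanning (insert i (insert j A) : Set ι) := by
    intro i j h hs
    refine hKA j ?_
    rw [spanning_iff_closure_eq (by simp [hK])] at hs ⊢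
    rwa [closure_insert_eq_of_mem_closure h] at hs
  have hmem : ∀ i j, K.Spanning (insert i (insert j A) : Set ι) → i ∉ K.closure A :=
    fun i j h hi => hns i j (K.closure_subset_closure (by simp) hi) h
  have hR : ∀ i j, x i * ((P.indepSpanningCount K (A.card + 2) (i ::ₘ j ::ₘ A.val) : ℝ) * x j) =
      y i * y j - if c i = c j then y i * y j else 0 := by
    intro i j
    rw [indepSpanningCount_cons_cons_val hP A hPA]
    by_cases hs : K.Spanning (insert i (insert j A) : Set ι)
    · have hs' := hs
      rw [Set.insert_comm] at hs'
      have hi : ∃ l, K.Spanning (insert l (insert i A) : Set ι) := ⟨j, hs'⟩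
      have hj : ∃ l, K.Spanning (insert l (insert j A) : Set ι) := ⟨i, hs⟩
      have hiA := hmem i j hs
      have h1 : i ∉ K.closure (insert j A : Set ι) := fun h => hns i j h hs
      have h2 : i ∉ P.closure (insert j A : Set ι) := fun h => h1 (hcl _ h)
      have h3 : j ∉ P.closure (A : Set ι) := fun h => hmem j i hs' (hcl _ h)
      have h4 : c i ≠ c j := (notMem_closure_insert_iff_closure_ne hK hiA).1 h1
      simp [hy, hi, hj, hs, h2, h3, h4]
    · by_cases hi : ∃ l, K.Spanning (insert l (insert i A) : Set ι)
      · by_cases hj : ∃ l, K.Spanning (insert l (insert j A) : Set ι)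
        · have hcij : c i = c j := by
            by_contra hne
            obtain ⟨k, hk⟩ := hi
            rw [Set.insert_comm] at hk
            have hiA := hmem i k hk
            have h1 := (notMem_closure_insert_iff_closure_ne hK hiA).2 hne
            obtain ⟨l, hl⟩ := hj
            exact hs (spanning_insert_of_notMem_closure hK hl h1)
          simp [hs, hcij]
        · simp [hs, hy, hj]
      · simp [hs, hy, hi]
  have hX : ∑ i, y i = 0 := by
    have : ∀ i, (if ∃ l, K.Spanning (insert l (insert i A) : Set ι) then (1 : ℝ) else 0) * x i
        = y i := fun i => by simp [hy]
    simp only [this] at hx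
    linarith
  have h0 := (sum_sum_ite_eq_nonneg_and_sq_sum_le c Finset.univ (y := y) (fun i hi => by
    simp at hi)).1
  have hform : P.indepSpanningForm K a A.card A.val x τ =
      - ∑ i, ∑ j, (if c i = c j then y i * y j else 0) := by
    have h2 : ∑ i, x i * ∑ j,
        (P.indepSpanningCount K (A.card + 2) (i ::ₘ j ::ₘ A.val) : ℝ) * x j =
        - ∑ i, ∑ j, (if c i = c j then y i * y j else 0) := by
      simp only [Finset.mul_sum, hR, Finset.sum_sub_distrib]
      rw [← Finset.sum_mul_sum, hX]
      ring
    rw [indepSpanningForm, borderedForm, h2, indepSpanningCount_val A hPA, if_neg hKA']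
    simp [indepSpanningCount_cons_val hP A hPA, hKA]
  rw [hform]
  linarith

theorem exists_indepSpanningForm_nonpos (hP : P.E = Set.univ)
    (hK : K.E = Set.univ) (hcl : ∀ X, P.closure X ⊆ K.closure X)
    {a k : ℕ} {L : Multiset ι} (hL : Multiset.card L = k) (hcard : Fintype.card ι = a + k + 2) :
    ∃ (u : ι → ℝ) (u₀ : ℝ), ∀ x τ, ∑ i, u i * x i + u₀ * τ = 0 →
      P.indepSpanningForm K a k L x τ ≤ 0 := by
  classical
  by_cases hnd : L.Nodup ∧ P.Indep (L.toFinset : Set ι)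
  swap
  -- No admissible set contains `L`, so the form is identically zero.
  · refine ⟨0, 0, fun x τ _ => le_of_eq ?_⟩
    have h0 : ∀ k L', L ≤ L' → P.indepSpanningCount K k L' = 0 := by
      intro k L' hL'
      by_contra hne
      obtain ⟨S, ⟨h1, -, -⟩, hLS⟩ := indepSpanningCount_pos_iff.1 (Nat.pos_of_ne_zero hne)
      exact hnd ⟨Multiset.nodup_of_le (hL'.trans hLS) S.nodup, h1.subset fun e he =>
        Multiset.mem_of_le (hL'.trans hLS) (Multiset.mem_toFinset.1 he)⟩
    have h1 : ∀ i, L ≤ i ::ₘ L := Multiset.le_cons_self L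
    simp [indepSpanningForm, borderedForm, h0 _ L le_rfl, h0 _ _ (h1 _),
      h0 _ _ ((h1 _).trans (Multiset.le_cons_self _ _))]
  obtain ⟨hnd, hPA⟩ := hnd
  obtain ⟨A, rfl⟩ : ∃ A : Finset ι, A.val = L := ⟨⟨L, hnd⟩, rfl⟩
  rw [Finset.val_toFinset] at hPA
  obtain rfl : A.card = k := hL
  by_cases hKA : K.Spanning (A : Set ι)
  · exact ⟨_, _, fun x τ hx => indepSpanningForm_nonpos_of_spanning hP hK hcard hPA hKA hx⟩
  by_cases hl : ∃ l, K.Spanning (insert l A : Set ι)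
  · obtain ⟨l, hl⟩ := hl
    exact ⟨_, _, fun x τ hx =>
      indepSpanningForm_nonpos_of_exists_spanning_insert hP hK hcl hPA hKA hl hx⟩
  · push Not at hl
    exact ⟨_, _, fun x τ hx =>
      indepSpanningForm_nonpos_of_not_spanning_insert hP hK hcl hPA hKA hl hx⟩

/-! ### Induction on the number of derivatives, and ultra-log-concavity. -/

/-- Euler's identity for the Hessian at `w₀ = 0`: all three kinds of entries scale by the same
factor `k - |L|`. -/
theorem sum_indepSpanningForm_cons (a k : ℕ) (L : Multiset ι) (x : ι → ℝ) (τ : ℝ) :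
    ∑ i, P.indepSpanningForm K a k (i ::ₘ L) x τ =
      ((k : ℝ) - Multiset.card L) * P.indepSpanningForm K a k L x τ := by
  have hc : ∀ k i, (∑ j, (P.indepSpanningCount K k (i ::ₘ j ::ₘ L) : ℝ)) =
      ((k : ℝ) - (Multiset.card L + 1)) * P.indepSpanningCount K k (i ::ₘ L) := by
    intro k i
    simp only [indepSpanningCount_cons_swap k i]
    rw [sum_indepSpanningCount_cons, Multiset.card_cons, Nat.cast_succ]
  have hcc : ∀ i j, (∑ l, (P.indepSpanningCount K (k + 2) (i ::ₘ j ::ₘ l ::ₘ L) : ℝ)) =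
      ((k : ℝ) - Multiset.card L) * P.indepSpanningCount K (k + 2) (i ::ₘ j ::ₘ L) := by
    intro i j
    have : ∀ l, i ::ₘ j ::ₘ l ::ₘ L = l ::ₘ i ::ₘ j ::ₘ L := fun l => by
      rw [Multiset.cons_swap j l, Multiset.cons_swap i l]
    simp only [this]
    rw [sum_indepSpanningCount_cons, Multiset.card_cons, Multiset.card_cons]
    push_cast
    ring
  simp only [indepSpanningForm, borderedForm, Finset.sum_add_distrib]
  rw [mul_add ((k : ℝ) - _), mul_add ((k : ℝ) - _)]
  congr 1
  · congr 1
    · simp only [Finset.mul_sum]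
      rw [Finset.sum_comm]
      refine Finset.sum_congr rfl fun i _ => ?_
      rw [Finset.sum_comm]
      refine Finset.sum_congr rfl fun j _ => ?_
      rw [← Finset.mul_sum, ← Finset.sum_mul, hcc]
      ring
    · rw [← Finset.mul_sum, Finset.sum_comm, mul_left_comm]
      congr 1
      rw [Finset.mul_sum]
      refine Finset.sum_congr rfl fun i _ => ?_
      rw [← Finset.sum_mul, ← Finset.mul_sum, hc]
      push_cast
      ring
  · rw [← Finset.sum_mul, ← Finset.mul_sum, sum_indepSpanningCount_cons]
    ring

theorem indepSpanningForm_reverse_cauchy_schwarz (hP : P.E = Set.univ) (hK : K.E = Set.univ)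
    (hcl : ∀ X, P.closure X ⊆ K.closure X) {a k : ℕ} (hcard : Fintype.card ι = a + k + 2)
    (hk : ((k + 2 : ℕ) : ℕ∞) ≤ P.eRank) {L : Multiset ι} (hL : Multiset.card L ≤ k)
    (x : ι → ℝ) (τ : ℝ) :
    P.indepSpanningForm K a k L x τ *
        ∑ i, ∑ j, (P.indepSpanningCount K (k + 2) (i ::ₘ j ::ₘ L) : ℝ) ≤
      (∑ i, (∑ j, (P.indepSpanningCount K (k + 2) (i ::ₘ j ::ₘ L) : ℝ) * x j +
        τ * ((a + 1) * (P.indepSpanningCount K (k + 1) (i ::ₘ L) : ℝ)))) ^ 2 := by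
  have hsymm : ∀ (L : Multiset ι) i j, (P.indepSpanningCount K (k + 2) (i ::ₘ j ::ₘ L) : ℝ) =
      P.indepSpanningCount K (k + 2) (j ::ₘ i ::ₘ L) := fun L i j => by
    rw [indepSpanningCount_cons_swap]
  have hzero : ∀ {l : ℕ} {L : Multiset ι}, l ≤ k + 2 → P.indepSpanningCount K (k + 2) L = 0 →
      P.indepSpanningCount K l L = 0 := by
    intro l L hl h
    by_contra hne
    exact (indepSpanningCount_pos_of_le hK hk hl (Nat.pos_of_ne_zero hne)).ne' h
  induction hb : k - Multiset.card L generalizing L x τ with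
  | zero =>
    obtain ⟨u, u₀, hu⟩ := exists_indepSpanningForm_nonpos hP hK hcl
      (by omega : Multiset.card L = k) hcard
    exact borderedForm_reverse_cauchy_schwarz (hsymm L) (fun i j => Nat.cast_nonneg _) u u₀ hu x τ
  | succ b ih =>
    have hbL : (k : ℝ) - Multiset.card L = b + 1 := by
      rw [← Nat.cast_sub hL, hb]; push_cast; rfl
    -- The functional is the pairing under the form itself with `(1, …, 1; 0)`: column sums of the
    -- matrix, and the sum of the border.
    refine borderedForm_reverse_cauchy_schwarz (hsymm L) (fun i j => Nat.cast_nonneg _)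
      (fun j => ∑ i, (P.indepSpanningCount K (k + 2) (i ::ₘ j ::ₘ L) : ℝ))
      (∑ i, (a + 1) * (P.indepSpanningCount K (k + 1) (i ::ₘ L) : ℝ)) (fun x τ hx => ?_) x τ
    have hD : ∀ i, ∑ j, (P.indepSpanningCount K (k + 2) (i ::ₘ j ::ₘ L) : ℝ) =
        (b + 2) * P.indepSpanningCount K (k + 2) (i ::ₘ L) := by
      intro i
      simp only [hsymm L i]
      rw [sum_indepSpanningCount_cons, Multiset.card_cons]
      push_cast
      rw [← sub_eq_iff_eq_add.2 hbL.symm]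
      ring
    refine bordered_quadForm_nonpos (hsymm L) (fun i j => Nat.cast_nonneg _) ?_ ?_ ?_ ?_
    · intro i hi
      rw [hD] at hi
      have : P.indepSpanningCount K (k + 2) (i ::ₘ L) = 0 := by
        exact_mod_cast (mul_eq_zero.1 hi).resolve_left (by positivity)
      rw [hzero (by omega) this]
      simp
    · intro x τ
      -- For `i ::ₘ L`, Euler's identity turns the total of the matrix into `b + 1` times row sum
      -- `i`, and the pairing into `b + 1` times coordinate `i` of the image of `(x; τ)`. Dividing
      -- the induction hypothesis by the row sum gives this bound, and summing over `i` gives the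
      -- Bochner inequality.
      have hterm : ∀ i, P.indepSpanningForm K a k (i ::ₘ L) x τ ≤ (b + 1) *
          ((∑ j, (P.indepSpanningCount K (k + 2) (i ::ₘ j ::ₘ L) : ℝ) * x j +
            τ * ((a + 1) * (P.indepSpanningCount K (k + 1) (i ::ₘ L) : ℝ))) ^ 2 /
          ∑ j, (P.indepSpanningCount K (k + 2) (i ::ₘ j ::ₘ L) : ℝ)) := by
        intro i
        by_cases hi : P.indepSpanningCount K (k + 2) (i ::ₘ L) = 0
        · have h1 : ∀ L', i ::ₘ L ≤ L' → P.indepSpanningCount K (k + 2) L' = 0 := by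
            intro L' hL'
            by_contra hne
            obtain ⟨S, hS, hLS⟩ := indepSpanningCount_pos_iff.1 (Nat.pos_of_ne_zero hne)
            exact (indepSpanningCount_pos_iff.2 ⟨S, hS, hL'.trans hLS⟩).ne' hi
          have h2 : ∀ j, i ::ₘ L ≤ j ::ₘ i ::ₘ L := Multiset.le_cons_self _
          refine le_of_eq_of_le (b := 0) ?_ (by positivity)
          simp [indepSpanningForm, borderedForm, hzero (by omega : k ≤ k + 2) hi,
            h1 _ ((h2 _).trans (Multiset.le_cons_self _ _)),
            hzero (by omega : k + 1 ≤ k + 2) (h1 _ (h2 _))]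
        · have h1 := ih (L := i ::ₘ L) (by rw [Multiset.card_cons]; omega) x τ
            (by rw [Multiset.card_cons]; omega)
          have hcc : ∀ l j, P.indepSpanningCount K (k + 2) (l ::ₘ j ::ₘ i ::ₘ L) =
              P.indepSpanningCount K (k + 2) (l ::ₘ i ::ₘ j ::ₘ L) := fun l j => by
            rw [Multiset.cons_swap j i]
          have hs2 : ∀ j, ∑ l, (P.indepSpanningCount K (k + 2) (l ::ₘ i ::ₘ j ::ₘ L) : ℝ) =
              (b + 1) * P.indepSpanningCount K (k + 2) (i ::ₘ j ::ₘ L) := by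
            intro j
            rw [sum_indepSpanningCount_cons, Multiset.card_cons, Multiset.card_cons]
            push_cast
            rw [← hbL]
            ring
          have hs1 : ∑ l, (P.indepSpanningCount K (k + 1) (l ::ₘ i ::ₘ L) : ℝ) =
              (b + 1) * P.indepSpanningCount K (k + 1) (i ::ₘ L) := by
            rw [sum_indepSpanningCount_cons, Multiset.card_cons]
            push_cast
            rw [← hbL]
            ring
          have h2 : ∑ l, ∑ j, (P.indepSpanningCount K (k + 2) (l ::ₘ j ::ₘ i ::ₘ L) : ℝ) =
              (b + 1) * ∑ j, (P.indepSpanningCount K (k + 2) (i ::ₘ j ::ₘ L) : ℝ) := by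
            simp only [hcc]
            rw [Finset.sum_comm, Finset.mul_sum]
            exact Finset.sum_congr rfl fun j _ => hs2 j
          have h3 : ∑ l, (∑ j, (P.indepSpanningCount K (k + 2) (l ::ₘ j ::ₘ i ::ₘ L) : ℝ) * x j +
              τ * ((a + 1) * (P.indepSpanningCount K (k + 1) (l ::ₘ i ::ₘ L) : ℝ))) =
              (b + 1) * (∑ j, (P.indepSpanningCount K (k + 2) (i ::ₘ j ::ₘ L) : ℝ) * x j +
            τ * ((a + 1) * (P.indepSpanningCount K (k + 1) (i ::ₘ L) : ℝ))) := by
            simp only [hcc]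
            rw [Finset.sum_add_distrib, Finset.sum_comm, ← Finset.mul_sum, ← Finset.mul_sum, hs1]
            simp only [← Finset.sum_mul, hs2, mul_assoc]
            rw [← Finset.mul_sum]
            ring
          rw [h2, h3] at h1
          have hpos : 0 < ∑ j, (P.indepSpanningCount K (k + 2) (i ::ₘ j ::ₘ L) : ℝ) := by
            rw [hD]
            have : (0 : ℝ) < P.indepSpanningCount K (k + 2) (i ::ₘ L) := by
              exact_mod_cast Nat.pos_of_ne_zero hi
            positivity
          rw [← mul_div_assoc, le_div_iff₀ hpos]
          have hb1 : (0 : ℝ) < b + 1 := by positivity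
          refine le_of_mul_le_mul_left (le_trans (le_of_eq ?_) (h1.trans (le_of_eq ?_))) hb1 <;>
            ring
      have h4 := Finset.sum_le_sum fun i (_ : i ∈ Finset.univ) => hterm i
      rw [sum_indepSpanningForm_cons, hbL, ← Finset.mul_sum] at h4
      exact le_of_mul_le_mul_left h4 (by positivity)
    · intro x hxx i j hi hj
      have hpos : ∀ i, 0 < ∑ j, (P.indepSpanningCount K (k + 2) (i ::ₘ j ::ₘ L) : ℝ) →
          0 < P.indepSpanningCount K (k + 2) (i ::ₘ L) := by
        intro i hi
        rw [hD] at hi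
        exact_mod_cast pos_of_mul_pos_right hi (by positivity)
      by_cases hij : i = j
      · rw [hij]
      rcases exists_common_neighbor hP hK hcl (by omega : Multiset.card L + 2 ≤ k + 2) hij
        (hpos i hi) (hpos j hj) with h | ⟨l, h, h'⟩
      · exact hxx i j (by exact_mod_cast h)
      · exact (hxx i l (by exact_mod_cast h)).trans (hxx l j (by exact_mod_cast h'))
    · rw [← hx, Finset.sum_add_distrib, Finset.sum_comm, ← Finset.mul_sum, mul_comm τ]
      simp only [Finset.sum_mul]

/-- Ultra-log-concavity of the numbers of independent spanning sets. -/
theorem indepSpanningCount_mul_le_sq (hP : P.E = Set.univ) (hK : K.E = Set.univ)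
    (hcl : ∀ X, P.closure X ⊆ K.closure X) {a k : ℕ} (hcard : Fintype.card ι = a + k + 2) :
    ((a : ℝ) + 2) * (k + 2) * (P.indepSpanningCount K k 0 * P.indepSpanningCount K (k + 2) 0) ≤
      (a + 1) * (k + 1) * (P.indepSpanningCount K (k + 1) 0 : ℝ) ^ 2 := by
  by_cases h0 : P.indepSpanningCount K (k + 2) 0 = 0
  · rw [h0]
    simp only [Nat.cast_zero, mul_zero]
    positivity
  have hk : ((k + 2 : ℕ) : ℕ∞) ≤ P.eRank := by
    obtain ⟨S, ⟨h1, -, h2⟩, -⟩ := indepSpanningCount_pos_iff.1 (Nat.pos_of_ne_zero h0)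
    rw [← h2, ← Set.encard_coe_eq_coe_finsetCard]
    exact h1.encard_le_eRank
  -- At `(0; 1)` the form is its corner entry, and its pairing with `(1, …, 1; 0)` is the sum of the
  -- border.
  have h1 := indepSpanningForm_reverse_cauchy_schwarz hP hK hcl hcard hk
    (L := 0) (by simp) 0 1
  have h2 : ∑ i, ∑ j, (P.indepSpanningCount K (k + 2) (i ::ₘ j ::ₘ 0) : ℝ) =
      (k + 2) * (k + 1) * P.indepSpanningCount K (k + 2) 0 := by
    rw [Finset.sum_comm]
    simp only [sum_indepSpanningCount_cons, ← Finset.mul_sum, Multiset.card_cons,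
      Multiset.card_zero]
    push_cast
    ring
  have h3 : ∑ i, (P.indepSpanningCount K (k + 1) (i ::ₘ 0) : ℝ) =
      (k + 1) * P.indepSpanningCount K (k + 1) 0 := by
    simp only [sum_indepSpanningCount_cons, Multiset.card_zero]
    push_cast
    ring
  rw [h2] at h1
  simp only [indepSpanningForm, borderedForm, Pi.zero_apply, mul_zero, Finset.sum_const_zero,
    zero_add, one_mul, ← Finset.mul_sum, h3, one_pow, mul_one] at h1
  have hpos : (0 : ℝ) < (a + 1) * (k + 1) := by positivity
  refine le_of_mul_le_mul_left (le_trans (le_of_eq ?_) (h1.trans (le_of_eq ?_))) hpos <;> ring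

end Matroid

/-! ### From morphisms to pairs of matroids on one ground set. -/

namespace Matroid

variable {α β : Type*} {M : Matroid α} {N : Matroid β} {f : α → β}

/-- Adding `e` from the `M`-closure does not raise the `M`-rank, so the morphism inequality forbids
a rise of the `N`-rank of the image. Finiteness of ranks permits the cancellation. -/
theorem IsMorphism.closure_restrictSubtype_subset [M.Finite] (hf : M.IsMorphism N f)
    (X : Set M.E) :
    (M.restrictSubtype M.E).closure X ⊆ (N.comap (f ∘ Subtype.val)).closure X := by
  intro e he
  have heM : (e : α) ∈ M.closure (Subtype.val '' X) := by
    simpa [restrictSubtype] using he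
  have hXE : (Subtype.val '' X : Set α) ⊆ M.E := by simp
  rw [comap_closure_eq, Set.mem_preimage, Set.image_comp]
  by_contra hcon
  have h1 := hf.rank_le (Subtype.val '' X) (insert (e : α) (Subtype.val '' X))
    (Set.subset_insert _ _) (Set.insert_subset e.2 hXE)
  rw [Set.image_insert_eq, eRk_insert_eq_add_one ⟨hf.mapsTo e.2, hcon⟩,
    ← M.eRk_insert_closure_eq, Set.insert_eq_of_mem heM, eRk_closure_eq] at h1
  have hfin : M.eRk (Subtype.val '' X) ≠ ⊤ := by
    rw [eRk_ne_top_iff]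
    exact M.isRkFinite_set _
  have hfin' : N.eRk (f '' (Subtype.val '' X)) ≠ ⊤ := by
    refine ne_top_of_le_ne_top (Set.encard_ne_top_iff.2 ?_) (N.eRk_le_encard _)
    exact (M.ground_finite.subset hXE).image f
  lift M.eRk (Subtype.val '' X) to ℕ using hfin with r
  lift N.eRk (f '' (Subtype.val '' X)) to ℕ using hfin' with s
  norm_cast at h1
  omega

/-- The pullback only sees the span of the range of `g`, hence the assumption that this range spans
`N`. -/
theorem comap_spanning_iff {ι : Type*} {g : ι → β} (hg : ∀ i, g i ∈ N.E)
    (hspan : N.Spanning (Set.range g)) {X : Set ι} :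
    (N.comap g).Spanning X ↔ N.Spanning (g '' X) := by
  have hE : g ⁻¹' N.E = Set.univ := Set.eq_univ_of_forall hg
  have hXE : g '' X ⊆ N.E := by
    rintro _ ⟨i, -, rfl⟩
    exact hg i
  rw [spanning_iff_closure_eq (by simp [hE]), spanning_iff_closure_eq hXE, comap_closure_eq,
    comap_ground_eq]
  constructor
  · intro h
    refine (N.closure_subset_ground _).antisymm ?_
    rw [← hspan.closure_eq]
    refine N.closure_subset_closure_of_subset_closure ?_
    rintro _ ⟨i, rfl⟩
    have : i ∈ g ⁻¹' N.closure (g '' X) := by rw [h, hE]; trivial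
    exact this
  · intro h
    rw [h]

theorem isMorphismBasis_iff (hf : Set.MapsTo f M.E N.E) {S : Set α} :
    M.IsMorphismBasis N f S ↔ M.Indep S ∧ N.Spanning (f '' S) := by
  have h1 : (∃ B, M.IsBase B ∧ S ⊆ B) ↔ M.Indep S :=
    ⟨fun ⟨B, hB, hS⟩ => hB.indep.subset hS, fun h => h.exists_isBase_superset⟩
  rw [IsMorphismBasis, h1]
  refine and_congr_right fun hS => ?_
  have hSE : f '' S ⊆ N.E := (hf.mono_left hS.subset_ground).image_subset
  rw [spanning_iff_exists_isBase_subset]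

theorem morphismBasisCount_eq_zero (hf : Set.MapsTo f M.E N.E)
    (h : ¬ N.Spanning (f '' M.E)) (k : ℕ) : M.morphismBasisCount N f k = 0 := by
  rw [morphismBasisCount, ← Set.ncard_empty (Set α)]
  congr 1
  refine Set.eq_empty_of_forall_notMem ?_
  rintro S ⟨hS, -⟩
  rw [isMorphismBasis_iff hf] at hS
  exact h (hS.2.superset (Set.image_mono hS.1.subset_ground) hf.image_subset)

theorem morphismBasisCount_eq [Fintype M.E] (hf : Set.MapsTo f M.E N.E)
    (h : N.Spanning (f '' M.E)) (k : ℕ) :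
    M.morphismBasisCount N f k =
      (M.restrictSubtype M.E).indepSpanningCount (N.comap (f ∘ Subtype.val)) k 0 := by
  classical
  have hsp : ∀ X : Set M.E, (N.comap (f ∘ Subtype.val)).Spanning X ↔
      N.Spanning (f '' (Subtype.val '' X)) := fun X => by
    rw [comap_spanning_iff (g := f ∘ Subtype.val) (fun i => hf i.2) (by rwa [Set.range_comp, Subtype.range_coe]),
      Set.image_comp]
  rw [morphismBasisCount, indepSpanningCount, ← Set.ncard_coe_finset]
  refine (Set.ncard_congr (fun (S : Finset M.E) _ => (Subtype.val '' (S : Set M.E) : Set α))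
    ?_ ?_ ?_).symm
  · intro S hS
    simp only [Finset.coe_filter, Finset.mem_univ, true_and, Set.mem_ofPred_eq,
      restrictSubtype_indep_iff, hsp] at hS
    refine ⟨(isMorphismBasis_iff hf).2 ⟨hS.1.1, hS.1.2.1⟩, ?_⟩
    rw [Subtype.val_injective.encard_image, Set.encard_coe_eq_coe_finsetCard, hS.1.2.2]
  · intro S T _ _ hST
    exact Finset.coe_injective (Subtype.val_injective.image_injective hST)
  · rintro S ⟨hS, hSk⟩
    rw [isMorphismBasis_iff hf] at hS
    have hSE := hS.1.subset_ground
    have himg : Subtype.val '' (Subtype.val ⁻¹' S : Set M.E) = S := by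
      rw [Subtype.image_preimage_coe, Set.inter_eq_right.2 hSE]
    refine ⟨(Subtype.val ⁻¹' S : Set M.E).toFinset, ?_, by rw [Set.coe_toFinset, himg]⟩
    simp only [Finset.coe_filter, Finset.mem_univ, true_and, Set.mem_ofPred_eq,
      restrictSubtype_indep_iff, hsp, Set.coe_toFinset, himg]
    refine ⟨⟨hS.1, hS.2, ?_⟩, Multiset.zero_le _⟩
    rw [← himg, Subtype.val_injective.encard_image, ← Set.coe_toFinset
      (Subtype.val ⁻¹' S : Set M.E), Set.encard_coe_eq_coe_finsetCard] at hSk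
    exact_mod_cast hSk

theorem choose_ratio_mul_le {a k : ℕ} {b₀ b₁ b₂ : ℝ}
    (h : ((a : ℝ) + 2) * (k + 2) * (b₀ * b₂) ≤ (a + 1) * (k + 1) * b₁ ^ 2) :
    b₀ / ((a + k + 2).choose k : ℝ) * (b₂ / ((a + k + 2).choose (k + 2) : ℝ)) ≤
      b₁ ^ 2 / ((a + k + 2).choose (k + 1) : ℝ) ^ 2 := by
  have h0 : (0 : ℝ) < (a + k + 2).choose k := by exact_mod_cast Nat.choose_pos (by omega)
  have h1 : (0 : ℝ) < (a + k + 2).choose (k + 1) := by exact_mod_cast Nat.choose_pos (by omega)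
  have h2 : (0 : ℝ) < (a + k + 2).choose (k + 2) := by exact_mod_cast Nat.choose_pos (by omega)
  have e1 : ((a + k + 2).choose (k + 1) : ℝ) * (k + 1) = (a + k + 2).choose k * (a + 2) := by
    have := Nat.choose_succ_right_eq (a + k + 2) k
    rw [show a + k + 2 - k = a + 2 by omega] at this
    exact_mod_cast this
  have e2 : ((a + k + 2).choose (k + 2) : ℝ) * (k + 2) = (a + k + 2).choose (k + 1) * (a + 1) := by
    have := Nat.choose_succ_right_eq (a + k + 2) (k + 1)
    rw [show a + k + 2 - (k + 1) = a + 1 by omega] at this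
    exact_mod_cast this
  generalize ((a + k + 2).choose k : ℝ) = c₀ at *
  generalize ((a + k + 2).choose (k + 1) : ℝ) = c₁ at *
  generalize ((a + k + 2).choose (k + 2) : ℝ) = c₂ at *
  have e0 : c₀ = c₁ * (k + 1) / (a + 2) := by
    rw [eq_div_iff (by positivity)]; exact e1.symm
  have e3 : c₂ = c₁ * (a + 1) / (k + 2) := by
    rw [eq_div_iff (by positivity)]; exact e2
  rw [e0, e3]
  have hpos : (0 : ℝ) < c₁ ^ 2 * ((a + 1) * (k + 1)) := by positivity
  calc b₀ / (c₁ * (k + 1) / (a + 2)) * (b₂ / (c₁ * (a + 1) / (k + 2)))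
      = (a + 2) * (k + 2) * (b₀ * b₂) / (c₁ ^ 2 * ((a + 1) * (k + 1))) := by
        field_simp
    _ ≤ (a + 1) * (k + 1) * b₁ ^ 2 / (c₁ ^ 2 * ((a + 1) * (k + 1))) := by gcongr
    _ = b₁ ^ 2 / c₁ ^ 2 := by field_simp

theorem isMorphism_uniformZeroOne (M : Matroid α) :
    M.IsMorphism uniformZeroOne (fun _ => ()) where
  mapsTo := fun _ _ => trivial
  rank_le := fun S₁ S₂ h _ => by
    simpa [uniformZeroOne] using M.eRk_mono h

theorem isMorphismBasis_uniformZeroOne_iff {S : Set α} :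
    M.IsMorphismBasis uniformZeroOne (fun _ => ()) S ↔ M.Indep S := by
  rw [isMorphismBasis_iff M.isMorphism_uniformZeroOne.mapsTo]
  simp [uniformZeroOne]

end Matroid

theorem theorem2 {α β : Type*} (M : Matroid α) (N : Matroid β) [M.Finite] [N.Finite]
    (f : α → β) (hf : M.IsMorphism N f) (n : ℕ) (hn : M.E.ncard = n) :
    -- log-concavity of `b_k(f) / C(n, k)`
    (∀ k : ℕ, 1 ≤ k → k + 1 ≤ n →
      ((M.morphismBasisCount N f (k - 1) : ℝ) / (n.choose (k - 1) : ℝ)) *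
          ((M.morphismBasisCount N f (k + 1) : ℝ) / (n.choose (k + 1) : ℝ)) ≤
        (M.morphismBasisCount N f k : ℝ) ^ 2 / (n.choose k : ℝ) ^ 2) ∧
    -- no internal zeros
    (∀ i j k : ℕ, i < j → j < k → k ≤ n →
      (M.morphismBasisCount N f i : ℝ) / (n.choose i : ℝ) ≠ 0 →
      (M.morphismBasisCount N f k : ℝ) / (n.choose k : ℝ) ≠ 0 →
      (M.morphismBasisCount N f j : ℝ) / (n.choose j : ℝ) ≠ 0) ∧
    -- the map to `U_{0,1}` is a morphism, whose bases are the independent sets of `M`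
    (M.IsMorphism Matroid.uniformZeroOne (fun _ => ()) ∧
      ∀ S : Set α, M.IsMorphismBasis Matroid.uniformZeroOne (fun _ => ()) S ↔ M.Indep S) := by
  classical
  refine ⟨?_, ?_, M.isMorphism_uniformZeroOne, fun S => Matroid.isMorphismBasis_uniformZeroOne_iff⟩
  -- If the image of the ground set does not span `N`, then `f` has no bases and every count is
  -- zero.
  all_goals by_cases hspan : N.Spanning (f '' M.E)
  · intro k hk hkn
    have : Fintype M.E := M.ground_finite.fintype
    obtain ⟨l, rfl⟩ : ∃ l, k = l + 1 := ⟨k - 1, by omega⟩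
    obtain ⟨a, rfl⟩ : ∃ a, n = a + l + 2 := ⟨n - (l + 2), by omega⟩
    have hcard : Fintype.card M.E = a + l + 2 := by
      rw [← hn, ← Nat.card_coe_set_eq, Nat.card_eq_fintype_card]
    simp only [Matroid.morphismBasisCount_eq hf.mapsTo hspan]
    exact Matroid.choose_ratio_mul_le (Matroid.indepSpanningCount_mul_le_sq (by simp)
      (Set.eq_univ_of_forall fun e => hf.mapsTo e.2) hf.closure_restrictSubtype_subset hcard)
  · intro k _ _
    simp [Matroid.morphismBasisCount_eq_zero hf.mapsTo hspan]
  · intro i j k hij hjk hkn hi hk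
    have : Fintype M.E := M.ground_finite.fintype
    rw [Matroid.morphismBasisCount_eq hf.mapsTo hspan, div_ne_zero_iff, Nat.cast_ne_zero,
      ← Nat.pos_iff_ne_zero] at hi hk ⊢
    refine ⟨?_, by exact_mod_cast (Nat.choose_pos (by omega)).ne'⟩
    obtain ⟨S, ⟨hS, -, hSk⟩, -⟩ := Matroid.indepSpanningCount_pos_iff.1 hk.1
    refine Matroid.indepSpanningCount_pos_of_le
      (Set.eq_univ_of_forall fun e => hf.mapsTo e.2) ?_ hij.le hi.1
    refine le_trans ?_ hS.encard_le_eRank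
    rw [Set.encard_coe_eq_coe_finsetCard, hSk]
    exact_mod_cast hjk.le
  · intro i j k _ _ _ hi
    simp [Matroid.morphismBasisCount_eq_zero hf.mapsTo hspan] at hi
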